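/- All graphs are finite and simple, and $[k]=\{1,\dots,k\}$. For a graph $G$: - $\chi(G)$ is the chromatic number of $G$. - The orthogonal rank $\xi(G)$ is the smallest $k$ such that unit vectors of $\mathbb{C}^k$ can be assigned to the vertices of $G$ with adjacent vertices receiving orthogonal vectors. - The quantum chromatic number $\chi_q(G)$ is the smallest $k$ for which there is a finite-dimensional entangled strategy that wins the $k$-colouring game on $G$ with certainty. In this game Alice and Bob receive vertices $x,y$ that are equal or adjacent and must output colours $a,b\in[k]$ with $a=b$ if and only if $x=y$. A strategy consists of a unit vector $\psi\in\mathbb{C}^m\otimes\mathbb{C}^n$ and measurements $\{E^x_a\}_a$ on $\mathbb{C}^m$, $\{F^y_b\}_b$ on $\mathbb{C}^n$, and it gives outputs $a,b$ on inputs $x,y$ with probability $\langle\psi,(E^x_a\otimes F^y_b)\psi\rangle$. - For $r\ge 1$, the rank-$r$ quantum chromatic number $\chi_q^{(r)}(G)$ is the smallest $k$ for which there are a nonzero finite-dimensional complex Hilbert space $\mathcal{H}$ and projective measurements $\{E^v_c\}_{c\in[k]}$ on $\mathcal{H}$, one for each vertex $v$, such that every projection $E^v_c$ has rank exactly $r$,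 and $E^u_cE^v_c=0$ for all adjacent $u,v$ and all $c\in[k]$. An $(r,k)$-vector clump is a family $(\psi_{i,j})_{i\in[r],\,j\in[k]}$ of pairwise orthogonal unit vectors in $\mathbb{C}^{rk}$. Two clumps $(\psi_{i,j})$, $(\psi'_{i,j})$ are orthogonal if $\sum_{j=1}^k\langle\psi_{i,j},\psi'_{i',j}\rangle=0$ for all $i,i'\in[r]$. Let $G_{21}$ be the graph whose vertices are the following 21 $(2,2)$-clumps, with two distinct vertices adjacent if and only if the clumps are orthogonal. Each clump is listed as $\psi_{1,1},\psi_{1,2}\mid\psi_{2,1},\psi_{2,2}$; a string of four symbols $+,0,-$ stands for the vector with entries $1,0,-1$, divided by its norm: $C_{1}$: +0-0, +0+0 | 0+0+, 0+0-; $C_{2}$: 00+-, +-00 | ++00, 00--; $C_{3}$: +0+0, -0+0 | 0+0+, 0-0+; $C_{4}$: +0-0, -0-0 | 0+0+, 0+0-; $C_{5}$: +-00, 00-- | ++00, 00-+; $C_{6}$: 0++0, 0+-0 | +00+, +00-; $C_{7}$: +0-0, +0+0 | 0+0+, 0-0+; $C_{8}$: +++-, --+- | +-++, -+++; $C_{9}$: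 +++-, -+++ | +-++, ++-+; $C_{10}$: 0+0-, 0-0- | +0-0, -0-0; $C_{11}$: +0-0, 0-0+ | 0+0+, +0+0; $C_{12}$: +--+, -+-+ | ++++, --++; $C_{13}$: ++--, ++++ | +-+-, -++-; $C_{14}$: 00+-, ++00 | 00++, +-00; $C_{15}$: 00+0, 0-00 | 000+, -000; $C_{16}$: 0+0-, 0+0+ | +0+0, +0-0; $C_{17}$: +---, ---+ | +-++, ++-+; $C_{18}$: ++--, +--+ | +-+-, ----; $C_{19}$: ++--, -++- | +-+-, ++++; $C_{20}$: 0++0, -00+ | +00+, 0-+0; $C_{21}$: +000, 000- | 0+00, 00-0. **Theorem.** The graph parameters $\chi_q^{(1)}$ and $\chi_q^{(2)}$ are distinct. More precisely, $$\chi_q(G_{21})=\chi_q^{(2)}(G_{21})=4\qquad\text{and}\qquad \xi(G_{21})=\chi_q^{(1)}(G_{21})=\chi(G_{21})=5 .$$ -/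

import Mathlib

open scoped ComplexOrder Kronecker

noncomputable section

/-! ### Orthogonal rank -/

/-- `G` has a `k`-dimensional orthogonal representation: an assignment of unit vectors of `ℂ^k` to
the vertices such that adjacent vertices receive orthogonal vectors. -/
def HasOrthogonalRep {V : Type*} (G : SimpleGraph V) (k : ℕ) : Prop :=
  ∃ ψ : V → EuclideanSpace ℂ (Fin k),
    (∀ v, ‖ψ v‖ = 1) ∧ ∀ u v, G.Adj u v → inner ℂ (ψ u) (ψ v) = 0

/-- The orthogonal rank: the smallest `k` such that `G` has a `k`-dimensional orthogonal
representation (`⊤` if there is none, as for Mathlib's `SimpleGraph.chromaticNumber`). -/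
def orthogonalRank {V : Type*} (G : SimpleGraph V) : ℕ∞ :=
  ⨅ k ∈ {k : ℕ | HasOrthogonalRep G k}, (k : ℕ∞)

/-! ### The colouring game and the quantum chromatic number -/

/-- A measurement (POVM) with outcomes in `A` on `ℂ^d`: positive semidefinite operators that sum
to the identity. -/
def IsPOVM {A : Type*} [Fintype A] {d : ℕ} (E : A → Matrix (Fin d) (Fin d) ℂ) : Prop :=
  (∀ a, (E a).PosSemidef) ∧ ∑ a, E a = 1

/-- A projective measurement with outcomes in `A` on `ℂ^d`: orthogonal projections that sum to the
identity. -/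
def IsProjectiveMeasurement {A : Type*} [Fintype A] {d : ℕ}
    (E : A → Matrix (Fin d) (Fin d) ℂ) : Prop :=
  (∀ a, IsStarProjection (E a)) ∧ ∑ a, E a = 1

/-- The (finite-dimensional, tensor product) quantum correlations with inputs in `X` and outputs in
`A`; `p x y a b` is the probability `p(a, b | x, y)`. Alice and Bob share a unit vector `ψ` of
`ℂ^m ⊗ ℂ^n`; on input `x` Alice measures `E x`, on input `y` Bob measures `F y`. -/
def IsQuantumCorrelation {X A : Type*} [Fintype A] (p : X → X → A → A → ℝ) : Prop :=
  ∃ (m n : ℕ) (ψ : EuclideanSpace ℂ (Fin m × Fin n))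
    (E : X → A → Matrix (Fin m) (Fin m) ℂ) (F : X → A → Matrix (Fin n) (Fin n) ℂ),
    ‖ψ‖ = 1 ∧ (∀ x, IsPOVM (E x)) ∧ (∀ y, IsPOVM (F y)) ∧
      ∀ x y a b, (p x y a b : ℂ) =
        inner ℂ ψ (Matrix.toEuclideanLin (E x a ⊗ₖ F y b) ψ)

/-- The correlation `p` wins the `k`-colouring game on `G` with certainty: when the inputs `x`, `y`
are equal or adjacent, the outputs `a`, `b` are equal if and only if the inputs are, i.e. all other
pairs of outputs have probability zero. -/
def WinsColouringGame {V : Type*} (G : SimpleGraph V) {k : ℕ}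
    (p : V → V → Fin k → Fin k → ℝ) : Prop :=
  ∀ x y, (x = y ∨ G.Adj x y) → ∀ a b, ¬(a = b ↔ x = y) → p x y a b = 0

/-- `G` is quantumly `k`-colourable: there is a perfect entangled strategy for the `k`-colouring
game on `G`. -/
def QuantumColourable {V : Type*} (G : SimpleGraph V) (k : ℕ) : Prop :=
  ∃ p : V → V → Fin k → Fin k → ℝ, IsQuantumCorrelation p ∧ WinsColouringGame G p

/-- The quantum chromatic number: the smallest `k` such that `G` is quantumly `k`-colourable. -/
def quantumChromaticNumber {V : Type*} (G : SimpleGraph V) : ℕ∞ :=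
  ⨅ k ∈ {k : ℕ | QuantumColourable G k}, (k : ℕ∞)

/-- `G` has a rank-`r` quantum `k`-colouring: an assignment of projective measurements with `k`
outcomes on a nonzero finite-dimensional Hilbert space to the vertices, all of whose projections
have rank exactly `r`, such that `E u c * E v c = 0` for all adjacent `u`, `v` and all colours `c`.
-/
def RankQuantumColourable {V : Type*} (r : ℕ) (G : SimpleGraph V) (k : ℕ) : Prop :=
  ∃ (d : ℕ) (E : V → Fin k → Matrix (Fin d) (Fin d) ℂ),
    0 < d ∧ (∀ v, IsProjectiveMeasurement (E v)) ∧ (∀ v c, (E v c).rank = r) ∧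
      ∀ u v, G.Adj u v → ∀ c, E u c * E v c = 0

/-- The rank-`r` quantum chromatic number: the smallest `k` such that `G` has a rank-`r` quantum
`k`-colouring. -/
def rankQuantumChromaticNumber {V : Type*} (r : ℕ) (G : SimpleGraph V) : ℕ∞ :=
  ⨅ k ∈ {k : ℕ | RankQuantumColourable r G k}, (k : ℕ∞)

/-! ### Vector clumps and their orthogonality graphs -/

/-- An `(r, k)`-vector clump: an `r × k` array of pairwise orthogonal unit vectors of `ℂ^(rk)`. -/
structure VectorClump (r k : ℕ) where
  vec : Fin r → Fin k → EuclideanSpace ℂ (Fin (r * k))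
  orthonormal : Orthonormal ℂ fun p : Fin r × Fin k => vec p.1 p.2

/-- Two clumps `ψ`, `φ` are orthogonal if `∑ j, ⟨ψ i j, φ i' j⟩ = 0` for all rows `i`, `i'`. -/
def VectorClump.IsOrthogonal {r k : ℕ} (ψ φ : VectorClump r k) : Prop :=
  ∀ i i', ∑ j, inner ℂ (ψ.vec i j) (φ.vec i' j) = 0

theorem VectorClump.IsOrthogonal.symm {r k : ℕ} {ψ φ : VectorClump r k}
    (h : ψ.IsOrthogonal φ) : φ.IsOrthogonal ψ := by
  intro i i'
  have h1 := congrArg (starRingEnd ℂ) (h i' i)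
  simpa [map_sum, inner_conj_symm] using h1

/-- The orthogonality graph of a family of clumps: distinct vertices are adjacent if and only if the
corresponding clumps are orthogonal. -/
def clumpOrthogonalityGraph {V : Type*} {r k : ℕ} (ψ : V → VectorClump r k) : SimpleGraph V where
  Adj u v := u ≠ v ∧ (ψ u).IsOrthogonal (ψ v)
  symm := ⟨fun _ _ h => ⟨h.1.symm, h.2.symm⟩⟩
  loopless := ⟨fun _ h => h.1 rfl⟩

/-! ### The graph `G21` -/

/-- The entries of the 21 clumps before normalization: `clumpTable v i j` is the vector in row `i`
and column `j` of clump `v` (numbered from `0`). -/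
def clumpTable : Fin 21 → Fin 2 → Fin 2 → Fin 4 → ℤ := ![
  ![![![1, 0, -1, 0], ![1, 0, 1, 0]],
    ![![0, 1, 0, 1], ![0, 1, 0, -1]]],
  ![![![0, 0, 1, -1], ![1, -1, 0, 0]],
    ![![1, 1, 0, 0], ![0, 0, -1, -1]]],
  ![![![1, 0, 1, 0], ![-1, 0, 1, 0]],
    ![![0, 1, 0, 1], ![0, -1, 0, 1]]],
  ![![![1, 0, -1, 0], ![-1, 0, -1, 0]],
    ![![0, 1, 0, 1], ![0, 1, 0, -1]]],
  ![![![1, -1, 0, 0], ![0, 0, -1, -1]],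
    ![![1, 1, 0, 0], ![0, 0, -1, 1]]],
  ![![![0, 1, 1, 0], ![0, 1, -1, 0]],
    ![![1, 0, 0, 1], ![1, 0, 0, -1]]],
  ![![![1, 0, -1, 0], ![1, 0, 1, 0]],
    ![![0, 1, 0, 1], ![0, -1, 0, 1]]],
  ![![![1, 1, 1, -1], ![-1, -1, 1, -1]],
    ![![1, -1, 1, 1], ![-1, 1, 1, 1]]],
  ![![![1, 1, 1, -1], ![-1, 1, 1, 1]],
    ![![1, -1, 1, 1], ![1, 1, -1, 1]]],
  ![![![0, 1, 0, -1], ![0, -1, 0, -1]],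
    ![![1, 0, -1, 0], ![-1, 0, -1, 0]]],
  ![![![1, 0, -1, 0], ![0, -1, 0, 1]],
    ![![0, 1, 0, 1], ![1, 0, 1, 0]]],
  ![![![1, -1, -1, 1], ![-1, 1, -1, 1]],
    ![![1, 1, 1, 1], ![-1, -1, 1, 1]]],
  ![![![1, 1, -1, -1], ![1, 1, 1, 1]],
    ![![1, -1, 1, -1], ![-1, 1, 1, -1]]],
  ![![![0, 0, 1, -1], ![1, 1, 0, 0]],
    ![![0, 0, 1, 1], ![1, -1, 0, 0]]],
  ![![![0, 0, 1, 0], ![0, -1, 0, 0]],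
    ![![0, 0, 0, 1], ![-1, 0, 0, 0]]],
  ![![![0, 1, 0, -1], ![0, 1, 0, 1]],
    ![![1, 0, 1, 0], ![1, 0, -1, 0]]],
  ![![![1, -1, -1, -1], ![-1, -1, -1, 1]],
    ![![1, -1, 1, 1], ![1, 1, -1, 1]]],
  ![![![1, 1, -1, -1], ![1, -1, -1, 1]],
    ![![1, -1, 1, -1], ![-1, -1, -1, -1]]],
  ![![![1, 1, -1, -1], ![-1, 1, 1, -1]],
    ![![1, -1, 1, -1], ![1, 1, 1, 1]]],
  ![![![0, 1, 1, 0], ![-1, 0, 0, 1]],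
    ![![1, 0, 0, 1], ![0, -1, 1, 0]]],
  ![![![1, 0, 0, 0], ![0, 0, 0, -1]],
    ![![0, 1, 0, 0], ![0, 0, -1, 0]]]]

theorem clumpTable_dot (v : Fin 21) (p q : Fin 2 × Fin 2) (h : p ≠ q) :
    ∑ l, clumpTable v p.1 p.2 l * clumpTable v q.1 q.2 l = 0 := by
  revert v p q
  decide

theorem clumpTable_sq_pos (v : Fin 21) (i j : Fin 2) : 0 < ∑ l, clumpTable v i j l ^ 2 := by
  revert v i j
  decide

/-- The Euclidean norms of the integer vectors of `clumpTable` (which are `1`, `√2` or `2`). -/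
def clumpNorm (v : Fin 21) (i j : Fin 2) : ℝ := √(∑ l, (clumpTable v i j l : ℝ) ^ 2)

/-- The vectors of the 21 clumps: the integer vectors of `clumpTable`, normalized. -/
def clumpVec (v : Fin 21) (i j : Fin 2) : EuclideanSpace ℂ (Fin 4) :=
  WithLp.toLp 2 fun l => (((clumpTable v i j l : ℝ) / clumpNorm v i j : ℝ) : ℂ)

theorem clumpVec_orthonormal (v : Fin 21) :
    Orthonormal ℂ fun p : Fin 2 × Fin 2 => clumpVec v p.1 p.2 := by
  have key : ∀ p q : Fin 2 × Fin 2, inner ℂ (clumpVec v p.1 p.2) (clumpVec v q.1 q.2) =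
      (((∑ l, (clumpTable v p.1 p.2 l : ℝ) * clumpTable v q.1 q.2 l) /
        (clumpNorm v p.1 p.2 * clumpNorm v q.1 q.2) : ℝ) : ℂ) := by
    intro p q
    simp only [clumpVec, PiLp.inner_apply, RCLike.inner_apply, Complex.conj_ofReal]
    rw [Finset.sum_div, Complex.ofReal_sum]
    refine Finset.sum_congr rfl fun l _ => ?_
    rw [← Complex.ofReal_mul]
    congr 1
    ring
  rw [orthonormal_iff_ite]
  intro p q
  rw [key]
  split_ifs with h
  · subst h
    have hpos : (0 : ℝ) < ∑ l, (clumpTable v p.1 p.2 l : ℝ) ^ 2 := by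
      exact_mod_cast clumpTable_sq_pos v p.1 p.2
    rw [clumpNorm, Real.mul_self_sqrt hpos.le]
    simp only [← pow_two]
    rw [div_self hpos.ne', Complex.ofReal_one]
  · have h0 : ∑ l, (clumpTable v p.1 p.2 l : ℝ) * clumpTable v q.1 q.2 l = 0 := by
      exact_mod_cast clumpTable_dot v p q h
    rw [h0]
    simp

/-- The 21 explicit `(2, 2)`-vector clumps. -/
def clump (v : Fin 21) : VectorClump 2 2 where
  vec := clumpVec v
  orthonormal := clumpVec_orthonormal v

/-- The orthogonality graph of the 21 explicit clumps. -/
def G21 : SimpleGraph (Fin 21) := clumpOrthogonalityGraph clump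

end

/-!
`G21` contains a clique of size four, and a winning strategy for the colouring game needs at least
as many colours as a clique has vertices (`QuantumColourable.le_of_isNClique`). Four colours
suffice, even with projections of rank two: a `(2, 2)`-clump `ψ` gives two orthogonal vectors
`∑ j, ψ i j ⊗ e j` of `ℂ⁴ ⊗ ℂ²`, and the plane they span and its images under the four Pauli matrices
acting on `ℂ²` decompose the space orthogonally (`rankQuantumColourable_clumpOrthogonalityGraph`).
Orthogonality of clumps is orthogonality of these planes. A rank-`r` quantum colouring becomes a
winning strategy on a maximally entangled state (`RankQuantumColourable.quantumColourable`).

There is an explicit colouring with five colours, a colouring gives a rank-one quantum colouring,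
and a rank-one quantum colouring gives an orthogonal representation of the same size. Therefore it
remains to see that `G21` has no orthogonal representation in `ℂ⁴`. The proof uses only two
combinatorial properties of the relation of orthogonality in dimension four (`IsOrthogonality`): no
vector is orthogonal to all four members of an orthogonal basis, and in an expansion `⟪u, v⟫ = ∑ ⟪u,
e⟫ ⟪e, v⟫ = 0` over a basis the number of nonzero terms is not one. With respect to the clique `0,
2, 9, 15` as a basis, the edge from `3` to `6` forces `7` to be parallel to `2` or to `9`. Hence
`0`, `7`, `15` and the other one of `2`, `9` are a basis, and a lemma about two planes
(`IsOrthogonality.dichotomy`) forces `8`, `10`, `5` and `11` to be parallel to vectors of this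
basis. All the cases that remain contradict the clique `0, 4, 7, 13` (`not_isOrthogonality_of_G21`).
-/

/-! ### Orthogonality in dimension four, combinatorially -/

/-- Four pairwise related points; for orthogonality in dimension four, an orthogonal basis. -/
structure IsFrame {V : Type*} (R : V → V → Prop) (a b c d : V) : Prop where
  ab : R a b
  ac : R a c
  ad : R a d
  bc : R b c
  bd : R b d
  cd : R c d

/-- The combinatorial properties of orthogonality of nonzero vectors of a four-dimensional inner
product space: `total` says that no vector is orthogonal to a basis, and `elim` that a sum
`⟪u, v⟫ = ∑ ⟪u, e⟫ ⟪e, v⟫ = 0` over a basis cannot have exactly one nonzero term. -/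
structure IsOrthogonality {V : Type*} (R : V → V → Prop) : Prop where
  symm : ∀ {u v}, R u v → R v u
  total : ∀ {a b c d u}, IsFrame R a b c d → R a u → R b u → R c u → ¬R d u
  elim : ∀ {a b c d u v}, IsFrame R a b c d → R u v → R a u ∨ R a v → R b u ∨ R b v →
    R c u ∨ R c v → R d u ∨ R d v

namespace IsOrthogonality

variable {V : Type*} {R : V → V → Prop}

theorem rotate (h : IsOrthogonality R) {a b c d : V} (F : IsFrame R a b c d) :
    IsFrame R b c d a :=
  ⟨F.bc, F.bd, h.symm F.ab, F.cd, h.symm F.ac, h.symm F.ad⟩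

theorem swap (h : IsOrthogonality R) {a b c d : V} (F : IsFrame R a b c d) :
    IsFrame R b a c d :=
  ⟨h.symm F.ab, F.bc, F.bd, F.ac, F.ad, F.cd⟩

theorem swap_right (h : IsOrthogonality R) {a b c d : V} (F : IsFrame R a b c d) :
    IsFrame R a b d c :=
  ⟨F.ab, F.ad, F.ac, F.bd, F.bc, h.symm F.cd⟩

/-- A vector orthogonal to `a`, `b`, `c` is parallel to `d`. -/
theorem of_parallel (h : IsOrthogonality R) {a b c d x y : V} (F : IsFrame R a b c d)
    (ha : R a x) (hb : R b x) (hc : R c x) (hxy : R x y) : R d y :=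
  (h.elim F hxy (.inl ha) (.inl hb) (.inl hc)).resolve_left (h.total F ha hb hc)

/-- If `x`, `y` span the plane of `c`, `d`, then a vector orthogonal to `x`, `y` is orthogonal
to `c`. -/
theorem of_plane (h : IsOrthogonality R) {a b c d x y z : V} (F : IsFrame R a b c d)
    (hax : R a x) (hbx : R b x) (hay : R a y) (hby : R b y) (hxy : R x y)
    (hxz : R x z) (hyz : R y z) (hdz : R d z) : R c z := by
  have F' := h.rotate (h.rotate (h.rotate F))
  have hx := h.elim F' hxz (.inr hdz) (.inl hax) (.inl hbx)
  have hy := h.elim F' hyz (.inr hdz) (.inl hay) (.inl hby)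
  by_contra hz
  have hcx := hx.resolve_right hz
  have hcy := hy.resolve_right hz
  exact (h.elim F hxy (.inl hax) (.inl hbx) (.inl hcx)).elim (h.total F hax hbx hcx)
    (h.total F hay hby hcy)

/-- Let `p` lie in the plane of `a`, `b`, let `q` lie in the plane of `c`, `d`, and let the plane
of `b`, `d` contain a vector `y` in the span of `p`, `q` and a vector `x` orthogonal to `p`, `q`.
Then `y` is parallel to `p` or to `q`, which makes `p` and `q` parallel to vectors of the basis. -/
theorem dichotomy (h : IsOrthogonality R) {a b c d p q s t x y : V} (F : IsFrame R a b c d)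
    (G : IsFrame R p q s t) (hcp : R c p) (hdp : R d p) (haq : R a q) (hbq : R b q)
    (hpx : R p x) (hqx : R q x) (hsy : R s y) (hty : R t y)
    (hax : R a x) (hcx : R c x) (hay : R a y) (hcy : R c y) :
    R a p ∧ R d q ∨ R b p ∧ R c q := by
  have F₁ := h.rotate F
  have F₂ := h.rotate F₁
  have G₁ := h.rotate G
  have p_or : R p a ∨ R p y :=
    h.elim G₁ hay (.inl (h.symm haq)) (.inr hsy) (.inr hty)
  have q_or : R q c ∨ R q y :=
    h.elim (h.rotate (h.swap G)) hcy (.inl (h.symm hcp)) (.inr hsy) (.inr hty)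
  have b_or : R b p ∨ R b x := h.elim F₂ hpx (.inl hcp) (.inl hdp) (.inr hax)
  have d_or : R d q ∨ R d x := h.elim F hqx (.inl haq) (.inl hbq) (.inr hcx)
  have hy : R p y → ¬R q y := fun hp hq => h.total (h.rotate G₁) hsy hty hp hq
  have hx : R b x → ¬R d x := fun hb => h.total F hax hb hcx
  have hp : R b p → ¬R a p := fun hb => h.total F₁ hb hcp hdp
  have hq : R d q → ¬R c q := fun hd hc => h.total F haq hbq hc hd
  have := @h.symm p a
  have := @h.symm q c
  tauto

end IsOrthogonality

/-! ### Adjacency, a clique and a colouring in `G21` -/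

/-- The vectors of each of the 21 clumps all have the same norm. -/
theorem clumpNorm_eq (v : Fin 21) (i j : Fin 2) : clumpNorm v i j = clumpNorm v 0 0 := by
  have h : ∀ (v : Fin 21) (i j : Fin 2),
      ∑ l, clumpTable v i j l ^ 2 = ∑ l, clumpTable v 0 0 l ^ 2 := by decide
  unfold clumpNorm
  congr 1
  exact_mod_cast h v i j

theorem clumpNorm_ne_zero (v : Fin 21) (i j : Fin 2) : clumpNorm v i j ≠ 0 :=
  (Real.sqrt_pos.2 (by exact_mod_cast clumpTable_sq_pos v i j)).ne'

theorem inner_clumpVec (u v : Fin 21) (i i' j : Fin 2) :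
    inner ℂ (clumpVec u i j) (clumpVec v i' j) =
      ((∑ l, clumpTable u i j l * clumpTable v i' j l : ℤ) : ℂ) /
        ((clumpNorm u 0 0 : ℂ) * clumpNorm v 0 0) := by
  simp only [clumpVec, PiLp.inner_apply, RCLike.inner_apply, Complex.conj_ofReal,
    clumpNorm_eq u i j, clumpNorm_eq v i' j]
  push_cast
  rw [Finset.sum_div]
  exact Finset.sum_congr rfl fun l _ => by ring

/-- Adjacency in `G21` in terms of the integer vectors: the common norm of the vectors of a clump
factors out of the sums of inner products, which makes adjacency decidable. -/
theorem G21_adj_iff (u v : Fin 21) : G21.Adj u v ↔ u ≠ v ∧ ∀ i i',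
    ∑ j, ∑ l, clumpTable u i j l * clumpTable v i' j l = 0 := by
  have key : ∀ i i', ∑ j, inner ℂ ((clump u).vec i j) ((clump v).vec i' j) = 0 ↔
      ∑ j, ∑ l, clumpTable u i j l * clumpTable v i' j l = 0 := by
    intro i i'
    have hs : ∑ j, inner ℂ ((clump u).vec i j) ((clump v).vec i' j) = ∑ j, _ :=
      Finset.sum_congr rfl fun j _ => inner_clumpVec u v i i' j
    rw [hs, ← Finset.sum_div, div_eq_zero_iff, or_iff_left (by simp [clumpNorm_ne_zero])]
    exact_mod_cast Iff.rfl
  simp only [G21, clumpOrthogonalityGraph, VectorClump.IsOrthogonal, key]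

instance : DecidableRel G21.Adj := fun u v => decidable_of_iff _ (G21_adj_iff u v).symm

theorem G21_isNClique : G21.IsNClique 4 {0, 2, 9, 15} := by
  rw [SimpleGraph.isNClique_iff, SimpleGraph.isClique_iff]
  constructor
  · decide
  · decide

theorem G21_colorable : G21.Colorable 5 :=
  ⟨SimpleGraph.Coloring.mk
    ![0, 0, 1, 0, 1, 0, 1, 2, 2, 2, 1, 1, 3, 3, 3, 3, 2, 4, 2, 1, 0] (by decide)⟩

/-! ### `G21` has no orthogonal representation in dimension four -/

/-- The end of the argument that `G21` has no orthogonal representation in dimension four, with the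
vertices `0`, `7`, `15`, `f` as a basis. The vertices `8`, `10` and `5`, `11` are parallel to basis
vectors, in one of two ways each. In each of the four cases this makes `14` or `20` and `17` or `18`
parallel to basis vectors, and these rule out an orthogonal basis `4`, `13` of the plane of `15`
and `f`. -/
theorem IsOrthogonality.false_of_parallel {R : Fin 21 → Fin 21 → Prop} (h : IsOrthogonality R)
    (hR : ∀ u v, G21.Adj u v → R u v) {f : Fin 21} (F : IsFrame R 0 7 15 f)
    (h5 : R f 5) (h8 : R f 8)
    (h₁ : R 7 8 ∧ R f 10 ∨ R 15 8 ∧ R 0 10) (h₂ : R 15 5 ∧ R 7 11 ∨ R 0 5 ∧ R f 11) : False := by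
  have F₁ := h.rotate F
  have F₂ := h.rotate F₁
  have F₃ := h.rotate F₂
  have par0 : ∀ {x y}, R 7 x → R 15 x → R f x → G21.Adj x y → R 0 y :=
    fun h7 h15 hf hxy => h.of_parallel F₁ h7 h15 hf (hR _ _ hxy)
  have par7 : ∀ {x y}, R 0 x → R 15 x → R f x → G21.Adj x y → R 7 y :=
    fun h0 h15 hf hxy => h.of_parallel F₂ h15 hf h0 (hR _ _ hxy)
  have par15 : ∀ {x y}, R 0 x → R 7 x → R f x → G21.Adj x y → R 15 y :=
    fun h0 h7 hf hxy => h.of_parallel F₃ hf h0 h7 (hR _ _ hxy)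
  have parf : ∀ {x y}, R 0 x → R 7 x → R 15 x → G21.Adj x y → R f y :=
    fun h0 h7 h15 hxy => h.of_parallel F h0 h7 h15 (hR _ _ hxy)
  have a0_4 := hR 0 4 (by decide)
  have a0_8 := hR 0 8 (by decide)
  have a0_11 := hR 0 11 (by decide)
  have a0_13 := hR 0 13 (by decide)
  have a7_4 := hR 7 4 (by decide)
  have a7_5 := hR 7 5 (by decide)
  have a7_10 := hR 7 10 (by decide)
  have a7_13 := hR 7 13 (by decide)
  have a15_10 := hR 15 10 (by decide)
  have a15_11 := hR 15 11 (by decide)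
  have a4_13 := hR 4 13 (by decide)
  rcases h₁ with ⟨h8', h10⟩ | ⟨h8', h10⟩ <;> rcases h₂ with ⟨h5', h11⟩ | ⟨h5', h11⟩
  · -- `8 ∥ 15`, `10 ∥ 0`, `5 ∥ 0`, `11 ∥ f`
    have b20 : R 15 20 := par15 a0_8 h8' h8 (by decide)
    have c20 : R 0 20 := par0 a7_10 a15_10 h10 (by decide)
    have d20 : R f 20 := parf a0_11 h11 a15_11 (by decide)
    have b14 : R 15 14 := par15 a0_8 h8' h8 (by decide)
    have c14 : R 0 14 := par0 a7_10 a15_10 h10 (by decide)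
    have d14 : R 7 14 := par7 c20 b20 d20 (by decide)
    have b17 : R 15 17 := par15 a0_8 h8' h8 (by decide)
    have c17 : R 0 17 := par0 a7_5 h5' h5 (by decide)
    have d17 : R f 17 := parf a0_11 h11 a15_11 (by decide)
    have b18 : R f 18 := parf a0_11 h11 a15_11 (by decide)
    have c18 : R 0 18 := par0 a7_5 h5' h5 (by decide)
    have d18 : R 7 18 := par7 c17 b17 d17 (by decide)
    exact h.total F a0_4 a7_4 (par15 c18 d18 b18 (by decide)) (parf c14 d14 b14 (by decide))
  · -- `8 ∥ 15`, `10 ∥ 0`, `5 ∥ 15`, `11 ∥ 7`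
    have b20 : R 15 20 := par15 a0_8 h8' h8 (by decide)
    have c20 : R 0 20 := par0 a7_10 a15_10 h10 (by decide)
    have d20 : R 7 20 := par7 a0_11 a15_11 h11 (by decide)
    have b18 : R 15 18 := par15 h5' a7_5 h5 (by decide)
    have c18 : R 0 18 := par0 a7_10 a15_10 h10 (by decide)
    have d18 : R 7 18 := par7 a0_11 a15_11 h11 (by decide)
    have b4 : R f 4 := parf c18 d18 b18 (by decide)
    have b13 : R f 13 := parf c20 d20 b20 (by decide)
    exact h.total F a0_13 a7_13 (h.of_parallel F₃ b4 a0_4 a7_4 a4_13) b13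
  · -- `8 ∥ 7`, `10 ∥ f`, `5 ∥ 0`, `11 ∥ f`
    have b14 : R 7 14 := par7 a0_8 h8' h8 (by decide)
    have c14 : R f 14 := parf h10 a7_10 a15_10 (by decide)
    have d14 : R 0 14 := par0 a7_5 h5' h5 (by decide)
    have b17 : R 7 17 := par7 a0_8 h8' h8 (by decide)
    have c17 : R f 17 := parf a0_11 h11 a15_11 (by decide)
    have d17 : R 0 17 := par0 a7_5 h5' h5 (by decide)
    have b4 : R 15 4 := par15 d14 b14 c14 (by decide)
    have b13 : R 15 13 := par15 d17 b17 c17 (by decide)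
    exact h.total F a0_13 a7_13 b13 (h.of_parallel F a0_4 a7_4 b4 a4_13)
  · -- `8 ∥ 7`, `10 ∥ f`, `5 ∥ 15`, `11 ∥ 7`
    have b14 : R 7 14 := par7 a0_8 h8' h8 (by decide)
    have c14 : R f 14 := parf h10 a7_10 a15_10 (by decide)
    have d14 : R 15 14 := par15 h5' a7_5 h5 (by decide)
    have b20 : R 7 20 := par7 a0_8 h8' h8 (by decide)
    have c20 : R f 20 := parf h10 a7_10 a15_10 (by decide)
    have d20 : R 0 20 := par0 b14 d14 c14 (by decide)
    have b18 : R 7 18 := par7 a0_11 a15_11 h11 (by decide)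
    have c18 : R f 18 := parf h10 a7_10 a15_10 (by decide)
    have d18 : R 15 18 := par15 h5' a7_5 h5 (by decide)
    have b17 : R 7 17 := par7 a0_11 a15_11 h11 (by decide)
    have c17 : R 15 17 := par15 h5' a7_5 h5 (by decide)
    have d17 : R 0 17 := par0 b18 d18 c18 (by decide)
    exact h.total F a0_13 a7_13 (par15 d20 b20 c20 (by decide)) (parf d17 b17 c17 (by decide))

/-- No orthogonality relation of dimension four contains adjacency in `G21`. In terms of the basis
`0`, `2`, `9`, `15`, adjacency of `3` and `6` leaves the two cases `3 ∥ 9`, `6 ∥ 0`, `7 ∥ 2` and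
`3 ∥ 0`, `6 ∥ 2`, `7 ∥ 9`. -/
theorem not_isOrthogonality_of_G21 {R : Fin 21 → Fin 21 → Prop}
    (hR : ∀ u v, G21.Adj u v → R u v) : ¬IsOrthogonality R := by
  intro h
  have frame : ∀ a b c d, (G21.Adj a b ∧ G21.Adj a c ∧ G21.Adj a d ∧ G21.Adj b c ∧
      G21.Adj b d ∧ G21.Adj c d) → IsFrame R a b c d :=
    fun a b c d ⟨ab, ac, ad, bc, bd, cd⟩ => ⟨hR _ _ ab, hR _ _ ac, hR _ _ ad, hR _ _ bc,
      hR _ _ bd, hR _ _ cd⟩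
  have E : IsFrame R 0 15 2 9 := frame _ _ _ _ (by decide)
  have E₁ := h.rotate E
  have E₂ := h.rotate E₁
  have E₃ := h.rotate E₂
  have G : IsFrame R 8 10 14 20 := frame _ _ _ _ (by decide)
  have H : IsFrame R 5 11 17 18 := frame _ _ _ _ (by decide)
  have a36 := hR 3 6 (by decide)
  have a15_3 := hR 15 3 (by decide)
  have a15_6 := hR 15 6 (by decide)
  have a23 := hR 2 3 (by decide)
  have a96 := hR 9 6 (by decide)
  have a07 := hR 0 7 (by decide)
  have a15_7 := hR 15 7 (by decide)
  have a0_15 := hR 0 15 (by decide)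
  rcases h.elim E₁ a36 (.inl a15_3) (.inl a23) (.inr a96) with h03 | h06
  · -- `3 ∥ 9`, so `7 ∥ 2` and `6 ∥ 0`
    have h97 : R 9 7 := h.of_parallel E h03 a15_3 a23 (hR 3 7 (by decide))
    have h26 : R 2 6 := h.of_parallel E₃ h97 a07 a15_7 (hR 7 6 (by decide))
    have F : IsFrame R 0 7 15 9 := ⟨a07, a0_15, hR _ _ (by decide), h.symm a15_7, h.symm h97,
      hR _ _ (by decide)⟩
    have F₁ := h.rotate F
    have F₂ := h.rotate F₁
    have par0 : ∀ {y}, G21.Adj 6 y → R 0 y := fun hy =>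
      h.of_parallel E₁ a15_6 h26 a96 (hR _ _ hy)
    have par7 : ∀ {y}, G21.Adj 2 y → R 7 y := fun hy =>
      h.of_parallel F₂ (hR 15 2 (by decide)) (hR 9 2 (by decide)) (hR 0 2 (by decide)) (hR _ _ hy)
    have h98 : R 9 8 := h.of_parallel E h03 a15_3 a23 (hR 3 8 (by decide))
    have h0_1 : R 0 1 := par0 (by decide)
    have h0_16 : R 0 16 := par0 (by decide)
    have h7_1 : R 7 1 := par7 (by decide)
    have h7_16 : R 7 16 := par7 (by decide)
    -- `1`, `16` span the plane of `15`, `9`, so `12`, `19` lie in the plane of `0`, `7`.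
    have h15_12 : R 15 12 := h.of_plane F h0_1 h7_1 h0_16 h7_16 (hR _ _ (by decide))
      (hR _ _ (by decide)) (hR _ _ (by decide)) (hR _ _ (by decide))
    have h15_19 : R 15 19 := h.of_plane F h0_1 h7_1 h0_16 h7_16 (hR _ _ (by decide))
      (hR _ _ (by decide)) (hR _ _ (by decide)) (hR _ _ (by decide))
    refine h.false_of_parallel hR F (hR _ _ (by decide)) h98 ?_ ?_
    · exact h.dichotomy (h.swap_right F₁) G (hR _ _ (by decide)) h98 (hR _ _ (by decide))
        (hR _ _ (by decide)) (hR 8 1 (by decide)) (hR 10 1 (by decide)) (hR 14 16 (by decide))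
        (hR 20 16 (by decide)) h7_1 h0_1 h7_16 h0_16
    · exact h.dichotomy (h.swap_right (h.rotate (h.swap F₂))) H (hR _ _ (by decide))
        (hR _ _ (by decide)) (hR _ _ (by decide)) (hR _ _ (by decide)) (hR 5 12 (by decide))
        (hR 11 12 (by decide)) (hR 17 19 (by decide)) (hR 18 19 (by decide)) h15_12
        (hR _ _ (by decide)) h15_19 (hR _ _ (by decide))
  · -- `6 ∥ 2`, so `7 ∥ 9` and `3 ∥ 0`
    have h27 : R 2 7 := h.of_parallel E₃ a96 h06 a15_6
      (hR 6 7 (by decide))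
    have h93 : R 9 3 := h.of_parallel E a07 a15_7 h27 (hR 7 3 (by decide))
    have F : IsFrame R 0 7 15 2 := ⟨a07, a0_15, hR _ _ (by decide), h.symm a15_7, h.symm h27,
      hR _ _ (by decide)⟩
    have F₁ := h.rotate F
    have F₂ := h.rotate F₁
    have par0 : ∀ {y}, G21.Adj 3 y → R 0 y := fun hy =>
      h.of_parallel E₁ a15_3 a23 h93 (hR _ _ hy)
    have par7 : ∀ {y}, G21.Adj 9 y → R 7 y := fun hy =>
      h.of_parallel F₂ (hR 15 9 (by decide)) (hR 2 9 (by decide)) (hR 0 9 (by decide)) (hR _ _ hy)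
    have h28 : R 2 8 := h.of_parallel E₃ a96 h06 a15_6 (hR 6 8 (by decide))
    have h0_12 : R 0 12 := par0 (by decide)
    have h0_19 : R 0 19 := par0 (by decide)
    have h7_12 : R 7 12 := par7 (by decide)
    have h7_19 : R 7 19 := par7 (by decide)
    -- `12`, `19` span the plane of `15`, `2`, so `1`, `16` lie in the plane of `0`, `7`.
    have h15_1 : R 15 1 := h.of_plane F h0_12 h7_12 h0_19 h7_19 (hR _ _ (by decide))
      (hR _ _ (by decide)) (hR _ _ (by decide)) (hR _ _ (by decide))
    have h15_16 : R 15 16 := h.of_plane F h0_12 h7_12 h0_19 h7_19 (hR _ _ (by decide))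
      (hR _ _ (by decide)) (hR _ _ (by decide)) (hR _ _ (by decide))
    refine h.false_of_parallel hR F (hR _ _ (by decide)) h28 (Or.symm ?_) (Or.symm ?_)
    · exact h.dichotomy (h.swap F₁) G h28 (hR _ _ (by decide)) (hR _ _ (by decide))
        (hR _ _ (by decide)) (hR 8 1 (by decide)) (hR 10 1 (by decide)) (hR 14 16 (by decide))
        (hR 20 16 (by decide)) h15_1 (hR _ _ (by decide)) h15_16 (hR _ _ (by decide))
    · exact h.dichotomy (h.rotate (h.rotate (h.rotate (h.swap F₁)))) H (hR _ _ (by decide))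
        (hR _ _ (by decide)) (hR _ _ (by decide)) (hR _ _ (by decide)) (hR 5 12 (by decide))
        (hR 11 12 (by decide)) (hR 17 19 (by decide)) (hR 18 19 (by decide)) h0_12 h7_12
        h0_19 h7_19

/-- Orthogonality of unit vectors in dimension four is an orthogonality relation in the
combinatorial sense. -/
theorem isOrthogonality_inner {V E : Type*} [NormedAddCommGroup E] [InnerProductSpace ℂ E]
    [FiniteDimensional ℂ E] (hE : Module.finrank ℂ E = 4) (ψ : V → E) (hψ : ∀ v, ‖ψ v‖ = 1) :
    IsOrthogonality fun u v => inner ℂ (ψ u) (ψ v) = 0 := by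
  have symm : ∀ {u v}, inner ℂ (ψ u) (ψ v) = 0 → inner ℂ (ψ v) (ψ u) = 0 :=
    fun h => inner_eq_zero_symm.1 h
  have basis : ∀ {a b c d}, IsFrame (fun u v => inner ℂ (ψ u) (ψ v) = 0) a b c d → ∀ u v,
      inner ℂ (ψ u) (ψ a) * inner ℂ (ψ a) (ψ v) + inner ℂ (ψ u) (ψ b) * inner ℂ (ψ b) (ψ v) +
        inner ℂ (ψ u) (ψ c) * inner ℂ (ψ c) (ψ v) + inner ℂ (ψ u) (ψ d) * inner ℂ (ψ d) (ψ v) =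
      inner ℂ (ψ u) (ψ v) := by
    intro a b c d F u v
    have hon : Orthonormal ℂ (ψ ∘ ![a, b, c, d]) := by
      refine ⟨fun i => hψ _, fun i j hij => ?_⟩
      fin_cases i <;> fin_cases j <;> first
        | exact absurd rfl hij
        | simp [F.ab, F.ac, F.ad, F.bc, F.bd, F.cd, symm F.ab, symm F.ac, symm F.ad, symm F.bc,
            symm F.bd, symm F.cd]
    have hcard : Fintype.card (Fin 4) = Module.finrank ℂ E := by simp [hE]
    have := ((basisOfOrthonormalOfCardEqFinrank hon hcard).toOrthonormalBasis
      (by simpa using hon)).sum_inner_mul_inner (ψ u) (ψ v)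
    simpa [Fin.sum_univ_four] using this
  refine ⟨symm, ?_, ?_⟩
  · intro a b c d u F ha hb hc hd
    have h := basis F u u
    rw [ha, hb, hc, hd, inner_self_eq_norm_sq_to_K, hψ] at h
    simp at h
  · intro a b c d u v F huv ha hb hc
    have h := basis F u v
    have zero : ∀ {e}, inner ℂ (ψ e) (ψ u) = 0 ∨ inner ℂ (ψ e) (ψ v) = 0 →
        inner ℂ (ψ u) (ψ e) * inner ℂ (ψ e) (ψ v) = 0 :=
      fun he => mul_eq_zero.2 (he.imp_left symm)
    rw [huv, zero ha, zero hb, zero hc, zero_add, zero_add, zero_add] at h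
    exact (mul_eq_zero.1 h).imp_left symm

theorem HasOrthogonalRep.le_of_isNClique {V : Type*} {G : SimpleGraph V} {k n : ℕ}
    (h : HasOrthogonalRep G k) {s : Finset V} (hs : G.IsNClique n s) : n ≤ k := by
  obtain ⟨ψ, hψ, hadj⟩ := h
  have hon : Orthonormal ℂ fun v : s => ψ v :=
    ⟨fun v => hψ v, fun u v huv => hadj u v (hs.isClique u.2 v.2 (Subtype.coe_ne_coe.2 huv))⟩
  simpa [hs.card_eq] using hon.linearIndependent.fintype_card_le_finrank

theorem five_le_of_hasOrthogonalRep_G21 {k : ℕ} (h : HasOrthogonalRep G21 k) : 5 ≤ k := by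
  have h4 := h.le_of_isNClique G21_isNClique
  by_contra hk
  obtain rfl : k = 4 := by omega
  obtain ⟨ψ, hψ, hadj⟩ := h
  exact not_isOrthogonality_of_G21 hadj (isOrthogonality_inner (by simp) ψ hψ)

/-! ### Rank-one quantum colourings and orthogonal representations -/

theorem rank_eq_trace_of_isIdempotentElem {d : ℕ} {M : Matrix (Fin d) (Fin d) ℂ}
    (hM : IsIdempotentElem M) : (M.rank : ℂ) = M.trace := by
  have h : IsIdempotentElem (Matrix.toLin' M) := by
    rw [IsIdempotentElem, Module.End.mul_eq_comp, ← Matrix.toLin'_mul, hM.eq]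
  rw [← Matrix.trace_toLin'_eq, (LinearMap.IsIdempotentElem.isProj_range _ h).trace]
  rfl

theorem toEuclideanLin_mul_apply {ι : Type*} [Fintype ι] [DecidableEq ι] (M N : Matrix ι ι ℂ)
    (x : EuclideanSpace ℂ ι) :
    Matrix.toEuclideanLin (M * N) x = Matrix.toEuclideanLin M (Matrix.toEuclideanLin N x) :=
  congrArg (WithLp.toLp 2) (Matrix.mulVec_mulVec x.ofLp M N).symm

/-- In a rank-one quantum `k`-colouring the space has dimension `k`, by taking traces, so unit
vectors in the ranges of the projections of a fixed colour form a `k`-dimensional representation. -/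
theorem RankQuantumColourable.hasOrthogonalRep {V : Type*} [Nonempty V] {G : SimpleGraph V}
    {k : ℕ} (h : RankQuantumColourable 1 G k) : HasOrthogonalRep G k := by
  obtain ⟨d, E, hd, hE, hrank, hadj⟩ := h
  obtain ⟨v₀⟩ := ‹Nonempty V›
  have hdk : d = k := by
    have h := congrArg Matrix.trace (hE v₀).2
    simp only [Matrix.trace_sum, Matrix.trace_one, Fintype.card_fin,
      ← rank_eq_trace_of_isIdempotentElem ((hE v₀).1 _).isIdempotentElem, hrank] at h
    simp at h
    exact_mod_cast h.symm
  subst hdk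
  have key : ∀ v, ∃ ψ : EuclideanSpace ℂ (Fin d), ‖ψ‖ = 1 ∧
      Matrix.toEuclideanLin (E v ⟨0, hd⟩) ψ = ψ := by
    intro v
    have hne : Matrix.toEuclideanLin (E v ⟨0, hd⟩) ≠ 0 := by
      intro h0
      have := hrank v ⟨0, hd⟩
      rw [(LinearEquiv.map_eq_zero_iff _).1 h0] at this
      simp at this
    obtain ⟨φ, hφ⟩ : ∃ φ, Matrix.toEuclideanLin (E v ⟨0, hd⟩) φ ≠ 0 := by
      by_contra! hall
      exact hne (LinearMap.ext hall)
    refine ⟨((‖Matrix.toEuclideanLin (E v ⟨0, hd⟩) φ‖ : ℂ)⁻¹) •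
      Matrix.toEuclideanLin (E v ⟨0, hd⟩) φ, ?_, ?_⟩
    · rw [norm_smul, norm_inv, Complex.norm_real, norm_norm,
        inv_mul_cancel₀ (norm_ne_zero_iff.2 hφ)]
    · rw [map_smul]
      rw [← toEuclideanLin_mul_apply, ((hE v).1 _).isIdempotentElem.eq]
  choose ψ hψ hfix using key
  refine ⟨ψ, hψ, fun u v huv => ?_⟩
  rw [← hfix u, ← hfix v, ← LinearMap.adjoint_inner_right,
    ← Matrix.toEuclideanLin_conjTranspose_eq_adjoint]
  have hs : (E u ⟨0, hd⟩).conjTranspose = E u ⟨0, hd⟩ := ((hE u).1 _).isSelfAdjoint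
  rw [hs, ← toEuclideanLin_mul_apply, hadj u v huv, map_zero, LinearMap.zero_apply,
    inner_zero_right]

/-! ### Quantum colourings from colourings and from clumps -/

/-- A rank-`r` quantum colouring from orthonormal bases: for each vertex `v`, the columns of `U v`
are an orthonormal basis indexed by `Fin r × C`, and the projection of colour `c` is the one onto
the span of the `r` basis vectors `(i, c)`. -/
theorem rankQuantumColourable_of_isometry {V ι C : Type*} [Fintype ι] [DecidableEq ι] [Nonempty ι]
    [Fintype C] [DecidableEq C] {G : SimpleGraph V} {r : ℕ}
    (hcard : Fintype.card ι = r * Fintype.card C) (U : V → Matrix ι (Fin r × C) ℂ)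
    (hU : ∀ v, (U v).conjTranspose * U v = 1)
    (hadj : ∀ u v, G.Adj u v → ∀ i i' c, ((U u).conjTranspose * U v) (i, c) (i', c) = 0) :
    RankQuantumColourable r G (Fintype.card C) := by
  let e := Fintype.equivFin ι
  let f := Fintype.equivFin C
  let W : V → Matrix (Fin (Fintype.card ι)) (Fin r × C) ℂ := fun v => (U v).submatrix e.symm id
  let D : C → Matrix (Fin r × C) (Fin r × C) ℂ :=
    fun c => Matrix.diagonal fun p => if p.2 = c then 1 else 0
  have gram : ∀ u v, (W u).conjTranspose * W v = (U u).conjTranspose * U v := by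
    intro u v
    simp only [W, Matrix.conjTranspose_submatrix]
    rw [Matrix.submatrix_mul_equiv, Matrix.submatrix_id_id]
  have hW : ∀ v, (W v).conjTranspose * W v = 1 := fun v => (gram v v).trans (hU v)
  have hW' : ∀ v, W v * (W v).conjTranspose = 1 := fun v =>
    (Matrix.mul_eq_one_comm_of_card_eq _ _ _ (by simp [hcard])).1 (hW v)
  have hDD : ∀ c, D c * D c = D c := by
    intro c
    simp [D, Matrix.diagonal_mul_diagonal]
  have hmul : ∀ u v c c', W u * D c * (W u).conjTranspose * (W v * D c' * (W v).conjTranspose) =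
      W u * (D c * ((W u).conjTranspose * W v) * D c') * (W v).conjTranspose := by
    intro u v c c'
    simp only [Matrix.mul_assoc]
  have hidem : ∀ v c, IsIdempotentElem (W v * D c * (W v).conjTranspose) := by
    intro v c
    rw [IsIdempotentElem, hmul, hW, Matrix.mul_one, hDD]
  refine ⟨Fintype.card ι, fun v c => W v * D (f.symm c) * (W v).conjTranspose, Fintype.card_pos,
    fun v => ⟨fun c => ⟨hidem v _, ?_⟩, ?_⟩, fun v c => ?_, fun u v huv c => ?_⟩
  · have hD : (D (f.symm c)).conjTranspose = D (f.symm c) := by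
      simp only [D, Matrix.diagonal_conjTranspose]
      congr 1
      ext p
      simp [apply_ite]
    rw [IsSelfAdjoint, Matrix.star_eq_conjTranspose]
    simp [Matrix.conjTranspose_mul, hD, Matrix.mul_assoc]
  · have hD : ∑ c, D (f.symm c) = 1 := by
      rw [Equiv.sum_comp f.symm D]
      ext p q
      simp [D, Matrix.sum_apply, Matrix.diagonal_apply, Matrix.one_apply]
    change ∑ c, W v * D (f.symm c) * (W v).conjTranspose = 1
    rw [← Matrix.sum_mul, ← Matrix.mul_sum, hD, Matrix.mul_one, hW']
  · have h := rank_eq_trace_of_isIdempotentElem (hidem v (f.symm c))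
    rw [Matrix.trace_mul_comm, ← Matrix.mul_assoc, hW, Matrix.one_mul] at h
    have htr : (D (f.symm c)).trace = r := by
      simp only [D, Matrix.trace_diagonal, Fintype.sum_prod_type]
      simp
    exact_mod_cast h.trans htr
  · have h0 : D (f.symm c) * ((W u).conjTranspose * W v) * D (f.symm c) = 0 := by
      ext p q
      obtain ⟨i, a⟩ := p
      obtain ⟨i', b⟩ := q
      rw [gram]
      simp only [D, Matrix.mul_diagonal, Matrix.diagonal_mul]
      by_cases ha : a = f.symm c
      · by_cases hb : b = f.symm c
        · simp [ha, hb, hadj u v huv]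
        · simp [hb]
      · simp [ha]
    simp only [hmul, h0, Matrix.mul_zero, Matrix.zero_mul]

/-- A colouring `col` gives the rank-one quantum colouring whose basis at `v` is the standard basis,
cyclically relabelled by `col v`. -/
theorem SimpleGraph.Colorable.rankQuantumColourable {V : Type*} {G : SimpleGraph V} {k : ℕ}
    [NeZero k] (h : G.Colorable k) : RankQuantumColourable 1 G k := by
  obtain ⟨col⟩ := h
  have := rankQuantumColourable_of_isometry (G := G) (ι := Fin k) (C := Fin k) (r := 1) (by simp)
    (fun v => Matrix.of fun l p => if l = p.2 + col v then 1 else 0) ?_ ?_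
  · simpa using this
  · intro v
    ext ⟨i, c⟩ ⟨i', c'⟩
    simp [Matrix.mul_apply, Matrix.one_apply, Subsingleton.elim i i', eq_comm]
  · intro u v huv i i' c
    simp [Matrix.mul_apply, (col.valid huv).symm]

/-- The orthogonality graph of a family of `(r, k)`-clumps has a rank-`r` quantum `k²`-colouring.
Row `i` of a clump gives the vector `∑ j, ψ i j ⊗ e j` of `ℂ^(rk) ⊗ ℂ^k`, and orthogonality of
clumps is orthogonality of these vectors. The colours `(a, b)` act on `ℂ^k` by a cyclic shift by `a`
and by the phases in row `b` of a complex Hadamard matrix `H`; as a clump is an orthonormal basis,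
the translates of its `r` vectors under these `k²` unitaries are orthogonal. -/
theorem rankQuantumColourable_clumpOrthogonalityGraph {V : Type*} {r k : ℕ} [NeZero r] [NeZero k]
    (ψ : V → VectorClump r k) (H : Matrix (Fin k) (Fin k) ℂ)
    (hH : ∀ b j, star (H b j) * H b j = 1) (hH' : H * H.conjTranspose = (k : ℂ) • 1) :
    RankQuantumColourable r (clumpOrthogonalityGraph ψ) (k * k) := by
  have hk : (k : ℂ) ≠ 0 := Nat.cast_ne_zero.2 (NeZero.ne k)
  have hsq : star ((√k : ℝ) : ℂ)⁻¹ * ((√k : ℝ) : ℂ)⁻¹ = (k : ℂ)⁻¹ := by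
    rw [RCLike.star_def, map_inv₀, Complex.conj_ofReal, ← mul_inv, ← Complex.ofReal_mul,
      Real.mul_self_sqrt (Nat.cast_nonneg k), Complex.ofReal_natCast]
  let U : V → Matrix (Fin (r * k) × Fin k) (Fin r × (Fin k × Fin k)) ℂ :=
    fun v => Matrix.of fun p q => ((√k : ℝ) : ℂ)⁻¹ * (H q.2.2 p.2 * (ψ v).vec q.1 (p.2 + q.2.1) p.1)
  have gram : ∀ u v i i' a a' b b', ((U u).conjTranspose * U v) (i, (a, b)) (i', (a', b')) =
      (k : ℂ)⁻¹ * ∑ j, star (H b j) * H b' j *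
        inner ℂ ((ψ u).vec i (j + a)) ((ψ v).vec i' (j + a')) := by
    intro u v i i' a a' b b'
    simp only [Matrix.mul_apply, Matrix.conjTranspose_apply, Fintype.sum_prod_type_right, U,
      Matrix.of_apply, PiLp.inner_apply, RCLike.inner_apply, Finset.mul_sum, star_mul']
    refine Finset.sum_congr rfl fun j _ => Finset.sum_congr rfl fun l _ => ?_
    rw [← hsq, RCLike.star_def]
    ring
  have := rankQuantumColourable_of_isometry (G := clumpOrthogonalityGraph ψ) (r := r)
    (by simp [mul_assoc]) U ?_ ?_
  · simpa using this
  · intro v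
    ext ⟨i, a, b⟩ ⟨i', a', b'⟩
    have hon := orthonormal_iff_ite.1 (ψ v).orthonormal
    rw [gram]
    have hon' : ∀ j, inner ℂ ((ψ v).vec i (j + a)) ((ψ v).vec i' (j + a')) =
        if i = i' ∧ a = a' then 1 else 0 := by
      intro j
      simpa using hon (i, j + a) (i', j + a')
    have hrow : ∑ j, star (H b j) * H b' j = if b' = b then (k : ℂ) else 0 := by
      have h := congrFun (congrFun hH' b') b
      simp only [Matrix.mul_apply, Matrix.conjTranspose_apply, Matrix.smul_apply,
        Matrix.one_apply, smul_eq_mul, mul_ite, mul_one, mul_zero] at h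
      rw [← h]
      exact Finset.sum_congr rfl fun j _ => mul_comm _ _
    simp only [hon', ← Finset.sum_mul, hrow, Matrix.one_apply, Prod.mk.injEq]
    by_cases hb : b = b'
    · subst hb
      by_cases hia : i = i' ∧ a = a' <;> simp [hia, hk]
    · simp [hb, Ne.symm hb]
  · intro u v huv i i' c
    obtain ⟨a, b⟩ := c
    rw [gram]
    simp only [hH, one_mul]
    have h := Equiv.sum_comp (Equiv.addRight a)
      fun j => inner ℂ ((ψ u).vec i j) ((ψ v).vec i' j)
    exact mul_eq_zero_of_right _ (h.trans (huv.2 i i'))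

theorem rankQuantumColourable_G21 : RankQuantumColourable 2 G21 4 := by
  refine rankQuantumColourable_clumpOrthogonalityGraph clump !![1, 1; 1, -1] ?_ ?_
  · intro b j
    fin_cases b <;> fin_cases j <;> simp
  · ext i j
    fin_cases i <;> fin_cases j <;> simp [Matrix.mul_apply, Fin.sum_univ_two] <;> norm_num

/-! ### Winning strategies from quantum colourings -/

theorem IsProjectiveMeasurement.isPOVM {A : Type*} [Fintype A] {d : ℕ}
    {E : A → Matrix (Fin d) (Fin d) ℂ} (h : IsProjectiveMeasurement E) : IsPOVM E := by
  refine ⟨fun a => ?_, h.2⟩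
  have hs : (E a).conjTranspose = E a := (h.1 a).isSelfAdjoint
  have := Matrix.posSemidef_conjTranspose_mul_self (E a)
  rwa [hs, (h.1 a).isIdempotentElem.eq] at this

theorem IsProjectiveMeasurement.trace_mul_eq_zero {A : Type*} [Fintype A] [DecidableEq A] {d : ℕ}
    {E : A → Matrix (Fin d) (Fin d) ℂ} (h : IsProjectiveMeasurement E) {a b : A} (hab : a ≠ b) :
    (E a * E b).trace = 0 := by
  have nonneg : ∀ c, 0 ≤ (E a * E c).trace := by
    intro c
    have ha : (E a).conjTranspose = E a := (h.1 a).isSelfAdjoint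
    have hc : (E c).conjTranspose = E c := (h.1 c).isSelfAdjoint
    have := (Matrix.posSemidef_conjTranspose_mul_self (E c * E a)).trace_nonneg
    rwa [Matrix.conjTranspose_mul, ha, hc, Matrix.mul_assoc, ← Matrix.mul_assoc (E c),
      (h.1 c).isIdempotentElem.eq, Matrix.trace_mul_comm, Matrix.mul_assoc,
      (h.1 a).isIdempotentElem.eq, Matrix.trace_mul_comm] at this
  have hsum : ∑ c, (E a * E c).trace = (E a * E a).trace := by
    rw [← Matrix.trace_sum, ← Matrix.mul_sum, h.2, Matrix.mul_one, (h.1 a).isIdempotentElem.eq]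
  rw [← Finset.add_sum_erase _ _ (Finset.mem_univ a), add_eq_left] at hsum
  exact (Finset.sum_eq_zero_iff_of_nonneg fun c _ => nonneg c).1 hsum b (by simp [hab.symm])

/-- The players share a maximally entangled state, and Bob measures the transposes of Alice's
projections; then `p x y a b = tr (E x a * E y b) / d`. -/
theorem RankQuantumColourable.quantumColourable {V : Type*} {G : SimpleGraph V} {r k : ℕ}
    (h : RankQuantumColourable r G k) : QuantumColourable G k := by
  obtain ⟨d, E, hd, hE, -, hadj⟩ := h
  have hd' : (d : ℂ) ≠ 0 := by exact_mod_cast hd.ne'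
  let ψ : EuclideanSpace ℂ (Fin d × Fin d) :=
    WithLp.toLp 2 fun p => if p.1 = p.2 then ((√d : ℝ) : ℂ)⁻¹ else 0
  have hsq : star ((√d : ℝ) : ℂ)⁻¹ * ((√d : ℝ) : ℂ)⁻¹ = (d : ℂ)⁻¹ := by
    rw [RCLike.star_def, map_inv₀, Complex.conj_ofReal, ← mul_inv, ← Complex.ofReal_mul,
      Real.mul_self_sqrt (Nat.cast_nonneg d), Complex.ofReal_natCast]
  have expect : ∀ M N : Matrix (Fin d) (Fin d) ℂ,
      inner ℂ ψ (Matrix.toEuclideanLin (M ⊗ₖ N.transpose) ψ) = (d : ℂ)⁻¹ * (M * N).trace := by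
    intro M N
    rw [← hsq]
    simp only [EuclideanSpace.inner_eq_star_dotProduct, Matrix.ofLp_toLpLin, Matrix.toLin'_apply,
      dotProduct, Matrix.mulVec, Matrix.kroneckerMap_apply, Fintype.sum_prod_type, ψ,
      Matrix.trace, Matrix.diag, Matrix.mul_apply, Pi.star_apply, Finset.mul_sum]
    simp [apply_ite (starRingEnd ℂ), mul_comm]
    simp only [Finset.mul_sum]
    exact Finset.sum_congr rfl fun _ _ => Finset.sum_congr rfl fun _ _ => by ring
  have hreal : ∀ x y a b, (((d : ℂ)⁻¹ * (E x a * E y b).trace).re : ℂ) =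
      (d : ℂ)⁻¹ * (E x a * E y b).trace := by
    intro x y a b
    rw [← Complex.conj_eq_iff_re, map_mul, map_inv₀, Complex.conj_natCast, ← RCLike.star_def,
      ← Matrix.trace_conjTranspose, Matrix.conjTranspose_mul, Matrix.trace_mul_comm]
    have ha : (E x a).conjTranspose = E x a := ((hE x).1 a).isSelfAdjoint
    have hb : (E y b).conjTranspose = E y b := ((hE y).1 b).isSelfAdjoint
    rw [ha, hb]
  refine ⟨fun x y a b => ((d : ℂ)⁻¹ * (E x a * E y b).trace).re,
    ⟨d, d, ψ, E, fun y b => (E y b).transpose, ?_, fun x => (hE x).isPOVM,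
      fun y => ⟨fun b => ((hE y).isPOVM.1 b).transpose, ?_⟩, fun x y a b => ?_⟩, ?_⟩
  · have h1 := expect 1 1
    rw [Matrix.transpose_one, Matrix.one_kronecker_one, Matrix.toLpLin_one, LinearMap.id_apply,
      Matrix.one_mul, Matrix.trace_one, Fintype.card_fin, inv_mul_cancel₀ hd',
      inner_self_eq_norm_sq_to_K] at h1
    have h2 : ‖ψ‖ ^ 2 = 1 := Complex.ofReal_injective (by push_cast; exact h1)
    exact (pow_eq_one_iff_of_nonneg (norm_nonneg _) two_ne_zero).1 h2
  · rw [← Matrix.transpose_sum, (hE y).2, Matrix.transpose_one]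
  · rw [hreal, expect]
  · intro x y hxy a b hab
    rcases hxy with rfl | hxy
    · have hne : a ≠ b := by simpa using hab
      simp [(hE x).trace_mul_eq_zero hne]
    · obtain rfl : a = b := by
        by_contra hne
        exact hab ⟨fun h => absurd h hne, fun h => absurd h hxy.ne⟩
      simp [hadj x y hxy]

/-! ### The clique bound -/

/-- The quantum chromatic number is at least the clique number. With `w x a = (E x a ⊗ 1) ψ`,
perfect play makes Alice's and Bob's outcomes agree on `ψ`, so for a fixed colour `a` the vectors
`w x a` of a clique are orthogonal, and `⟪ψ, w x a⟫ = ‖w x a‖ ^ 2`. Bessel's inequality gives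
`∑ x, ‖w x a‖ ^ 2 ≤ 1`, and summing over the colours bounds the size of the clique by `k`. -/
theorem QuantumColourable.le_of_isNClique {V : Type*} {G : SimpleGraph V} {k n : ℕ}
    (h : QuantumColourable G k) {s : Finset V} (hs : G.IsNClique n s) : n ≤ k := by
  obtain ⟨p, ⟨m, m', ψ, E, F, hψ, hE, hF, hp⟩, hwin⟩ := h
  let A : V → Fin k → EuclideanSpace ℂ (Fin m × Fin m') →ₗ[ℂ] EuclideanSpace ℂ (Fin m × Fin m') :=
    fun x a => Matrix.toEuclideanLin (E x a ⊗ₖ 1)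
  let B : V → Fin k → EuclideanSpace ℂ (Fin m × Fin m') →ₗ[ℂ] EuclideanSpace ℂ (Fin m × Fin m') :=
    fun y b => Matrix.toEuclideanLin (1 ⊗ₖ F y b)
  have hAB : ∀ x y a b φ, A x a (B y b φ) = Matrix.toEuclideanLin (E x a ⊗ₖ F y b) φ := by
    intro x y a b φ
    rw [← toEuclideanLin_mul_apply, ← Matrix.mul_kronecker_mul, Matrix.mul_one, Matrix.one_mul]
  have hA : ∀ x φ, ∑ a, A x a φ = φ := by
    intro x φ
    have hsum : ∑ a, E x a ⊗ₖ (1 : Matrix (Fin m') (Fin m') ℂ) = 1 := by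
      rw [← Matrix.one_kronecker_one, ← (hE x).2]
      ext p q
      simp [Matrix.sum_apply, Finset.sum_mul]
    rw [← LinearMap.sum_apply, ← map_sum, hsum, Matrix.toLpLin_one, LinearMap.id_apply]
  have hB : ∀ y φ, ∑ b, B y b φ = φ := by
    intro y φ
    have hsum : ∑ b, (1 : Matrix (Fin m) (Fin m) ℂ) ⊗ₖ F y b = 1 := by
      rw [← Matrix.one_kronecker_one, ← (hF y).2]
      ext p q
      simp [Matrix.sum_apply, Finset.mul_sum]
    rw [← LinearMap.sum_apply, ← map_sum, hsum, Matrix.toLpLin_one, LinearMap.id_apply]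
  have hsymm : ∀ x a φ χ, inner ℂ (A x a φ) χ = inner ℂ φ (A x a χ) := by
    intro x a φ χ
    have hH : (E x a ⊗ₖ (1 : Matrix (Fin m') (Fin m') ℂ)).conjTranspose = E x a ⊗ₖ 1 := by
      rw [Matrix.conjTranspose_kronecker, ((hE x).1 a).isHermitian.eq, Matrix.conjTranspose_one]
    rw [← LinearMap.adjoint_inner_right, ← Matrix.toEuclideanLin_conjTranspose_eq_adjoint, hH]
  have hzero : ∀ x y a b, (x = y ∨ G.Adj x y) → ¬(a = b ↔ x = y) → A x a (B y b ψ) = 0 := by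
    intro x y a b hxy hab
    have h0 := hp x y a b
    rw [hwin x y hxy a b hab, Complex.ofReal_zero, EuclideanSpace.inner_eq_star_dotProduct,
      dotProduct_comm, Matrix.ofLp_toLpLin, Matrix.toLin'_apply] at h0
    have := (((hE x).1 a).kronecker ((hF y).1 b)).dotProduct_mulVec_zero_iff _ |>.1 h0.symm
    rw [hAB]
    exact congrArg (WithLp.toLp 2) this
  -- Alice's outcome `a` on `ψ` is Bob's outcome `a`: expand in the other player's measurement.
  have hw : ∀ x a, A x a ψ = B x a ψ := by
    intro x a
    have h1 : A x a ψ = A x a (B x a ψ) := by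
      conv_lhs => rw [← hB x ψ, map_sum]
      exact Finset.sum_eq_single a (fun b _ hb => hzero x x a b (.inl rfl) (by simp [hb.symm]))
        (by simp)
    have h2 : B x a ψ = A x a (B x a ψ) := by
      conv_lhs => rw [← hA x (B x a ψ)]
      exact Finset.sum_eq_single a (fun b _ hb => hzero x x b a (.inl rfl) (by simp [hb]))
        (by simp)
    rw [h1, ← h2]
  have horth : ∀ x y a b, (x = y ∨ G.Adj x y) → ¬(a = b ↔ x = y) →
      inner ℂ (A x a ψ) (A y b ψ) = 0 := by
    intro x y a b hxy hab
    rw [hw y b, hsymm, hzero x y a b hxy hab, inner_zero_right]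
  have hself : ∀ x a, inner ℂ ψ (A x a ψ) = (‖A x a ψ‖ : ℂ) ^ 2 := by
    intro x a
    have : inner ℂ (∑ b, A x b ψ) (A x a ψ) = inner ℂ (A x a ψ) (A x a ψ) := by
      rw [sum_inner]
      exact Finset.sum_eq_single a (fun b _ hb => horth x x b a (.inl rfl) (by simp [hb]))
        (by simp)
    rw [hA] at this
    rw [this, inner_self_eq_norm_sq_to_K]
    rfl
  have hone : ∀ x, ∑ a, ‖A x a ψ‖ ^ 2 = 1 := by
    intro x
    have : inner ℂ ψ (∑ a, A x a ψ) = inner ℂ ψ ψ := by rw [hA]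
    rw [inner_sum, inner_self_eq_norm_sq_to_K, hψ] at this
    simp only [hself] at this
    simp only [RCLike.ofReal_one, one_pow] at this
    exact_mod_cast this
  have hbessel : ∀ a, ∑ x ∈ s, ‖A x a ψ‖ ^ 2 ≤ 1 := by
    intro a
    have h1 : inner ℂ ψ (∑ x ∈ s, A x a ψ) = ((∑ x ∈ s, ‖A x a ψ‖ ^ 2 : ℝ) : ℂ) := by
      rw [inner_sum]
      simp only [hself]
      push_cast
      rfl
    have h2 : inner ℂ (∑ x ∈ s, A x a ψ) (∑ x ∈ s, A x a ψ) =
        ((∑ x ∈ s, ‖A x a ψ‖ ^ 2 : ℝ) : ℂ) := by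
      rw [sum_inner]
      push_cast
      refine Finset.sum_congr rfl fun x hx => ?_
      rw [inner_sum, Finset.sum_eq_single_of_mem x hx fun y hy hyx => horth x y a a
        (.inr (hs.isClique hx hy hyx.symm)) (by simp [hyx.symm]), inner_self_eq_norm_sq_to_K]
      rfl
    have h3 : ‖∑ x ∈ s, A x a ψ‖ ^ 2 = ∑ x ∈ s, ‖A x a ψ‖ ^ 2 := by
      rw [inner_self_eq_norm_sq_to_K] at h2
      exact Complex.ofReal_injective ((Complex.ofReal_pow _ _).trans h2)
    -- The orthogonal projection of `ψ` to the span of the `w x a` is their sum.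
    have h4 := norm_sub_sq (𝕜 := ℂ) ψ (∑ x ∈ s, A x a ψ)
    rw [h1, h3, hψ] at h4
    have h5 : RCLike.re ((∑ x ∈ s, ‖A x a ψ‖ ^ 2 : ℝ) : ℂ) = ∑ x ∈ s, ‖A x a ψ‖ ^ 2 :=
      Complex.ofReal_re _
    nlinarith [sq_nonneg ‖ψ - ∑ x ∈ s, A x a ψ‖]
  have hfinal : ((n : ℕ) : ℝ) ≤ k := by
    calc (n : ℝ) = ∑ x ∈ s, ∑ a, ‖A x a ψ‖ ^ 2 := by simp [hone, hs.card_eq]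
      _ = ∑ a, ∑ x ∈ s, ‖A x a ψ‖ ^ 2 := Finset.sum_comm
      _ ≤ ∑ _a : Fin k, (1 : ℝ) := Finset.sum_le_sum fun a _ => hbessel a
      _ = k := by simp
  exact_mod_cast hfinal

/-! ### The chromatic parameters of `G21` -/

theorem iInf_natCast_eq {P : ℕ → Prop} {n : ℕ} (hn : P n) (hmin : ∀ k, P k → n ≤ k) :
    ⨅ k ∈ {k : ℕ | P k}, (k : ℕ∞) = n :=
  le_antisymm (iInf₂_le n hn) (le_iInf₂ fun k hk => Nat.cast_le.2 (hmin k hk))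

theorem theorem2 :
    (∃ (n : ℕ) (G : SimpleGraph (Fin n)),
      rankQuantumChromaticNumber 1 G ≠ rankQuantumChromaticNumber 2 G) ∧
    quantumChromaticNumber G21 = 4 ∧ rankQuantumChromaticNumber 2 G21 = 4 ∧
    orthogonalRank G21 = 5 ∧ rankQuantumChromaticNumber 1 G21 = 5 ∧
    G21.chromaticNumber = 5 := by
  have hQ : quantumChromaticNumber G21 = 4 :=
    iInf_natCast_eq rankQuantumColourable_G21.quantumColourable
      fun k hk => QuantumColourable.le_of_isNClique hk G21_isNClique
  have hR2 : rankQuantumChromaticNumber 2 G21 = 4 :=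
    iInf_natCast_eq rankQuantumColourable_G21
      fun k hk => hk.quantumColourable.le_of_isNClique G21_isNClique
  have hξ : orthogonalRank G21 = 5 :=
    iInf_natCast_eq G21_colorable.rankQuantumColourable.hasOrthogonalRep
      fun k hk => five_le_of_hasOrthogonalRep_G21 hk
  have hR1 : rankQuantumChromaticNumber 1 G21 = 5 :=
    iInf_natCast_eq G21_colorable.rankQuantumColourable
      fun k hk => five_le_of_hasOrthogonalRep_G21 hk.hasOrthogonalRep
  have hχ : G21.chromaticNumber = 5 := by
    refine iInf_natCast_eq (P := G21.Colorable) (n := 5) G21_colorable fun k hk => ?_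
    obtain ⟨c⟩ := id hk
    have : NeZero k := ⟨(c 0).pos.ne'⟩
    exact five_le_of_hasOrthogonalRep_G21 hk.rankQuantumColourable.hasOrthogonalRep
  refine ⟨⟨21, G21, ?_⟩, hQ, hR2, hξ, hR1, hχ⟩
  rw [hR1, hR2]
  decide
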